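/- Let $X$ be a smooth manifold of dimension $n+1$ with a fibration $\pi:X\to\mathbb R$ over the time axis, covered by adapted charts $(x^0,x^i)$, $1\le i\le n$, with $x^0=\pi+\mathrm{const}$. Identify the first order jet manifold $J^1X$ with $\{v\in TX: d\pi(v)=1\}$, and let $L$ be a quadratic Lagrangian on $J^1X$: in every adapted chart $L=\tfrac12 m_{ij}(x)x^i_0x^j_0+k_i(x)x^i_0+f(x)$ with smooth coefficients and $m_{ij}$ symmetric positive definite. In each adapted chart put $g_{00}=-2f$, $g_{0i}=g_{i0}=-k_i$, $g_{ij}=-m_{ij}$, $\{_{\lambda\mu\nu}\}=-\tfrac12(\partial_\lambda g_{\mu\nu}+\partial_\nu g_{\mu\lambda}-\partial_\mu g_{\lambda\nu})$, and let $\overline K$ be the linear connection $$\overline K_\lambda{}^0{}_\nu=0,\qquad \overline K_\lambda{}^i{}_\nu=(-m^{-1})^{ik}\{_{\lambda k\nu}\},$$ with curvature (the signs of $\overline K$ and $R$ being opposite to the usual ones) $$R_{\lambda\mu}{}^\alpha{}_\beta=\partial_\lambda \overline K_\mu{}^\alpha{}_\beta-\partial_\mu \overline K_\lambda{}^\alpha{}_\beta+\overline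 K_\lambda{}^\gamma{}_\beta \overline K_\mu{}^\alpha{}_\gamma-\overline K_\mu{}^\gamma{}_\beta \overline K_\lambda{}^\alpha{}_\gamma .$$ A geodesic motion is a $C^2$ curve $c:J\to X$ on an interval $J\subset\mathbb R$ with $\dot x^0=1$ and $\ddot x^\mu=\overline K_\lambda{}^\mu{}_\nu\dot x^\lambda\dot x^\nu$ in adapted charts. A Jacobi field along $c|_{[a,b]}$ is a $C^2$ vector field $u$ along it with $\frac{D^2u^\alpha}{dt^2}=R_{\lambda\mu}{}^\alpha{}_\beta u^\lambda\dot x^\mu\dot x^\beta$, where $\frac{Du^\alpha}{dt}=\frac{du^\alpha}{dt}-\overline K_\lambda{}^\alpha{}_\nu\dot x^\lambda u^\nu$. For $a<b$ in $J$, the points $c(a),c(b)$ are conjugate along $c$ if some Jacobi field along $c|_{[a,b]}$, not identically zero, vanishes at $a$ and at $b$. Given a reference frame, i.e. a smooth vector field $\Gamma=\partial_0+\Gamma^i\partial_i$ on $X$, let $\overline g=-dx^0\otimes dx^0-m_{ij}(dx^i-\Gamma^idx^0)\otimes(dx^j-\Gamma^jdx^0)$; in coordinates with $\Gamma^i=0$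 this reads $\overline g_{00}=-1$, $\overline g_{0i}=0$, $\overline g_{ij}=-m_{ij}$. Put $R_{\lambda\mu\alpha\nu}=\overline g_{\alpha\beta}R_{\lambda\mu}{}^\beta{}_\nu$. Proposition. Let $c:J\to X$ be a geodesic motion. If the sectional curvature along the motion is nonpositive, i.e. $R_{\lambda\mu\alpha\nu}u^\lambda u^\alpha\dot x^\mu\dot x^\nu\le 0$ at $c(t)$ for every $t\in J$ and every tangent vector $u$ at $c(t)$ with $u^0=0$, then the motion has no conjugate points: for no $a<b$ in $J$ are $c(a)$ and $c(b)$ conjugate along $c$. -/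

import Mathlib

open scoped Manifold ContDiff

noncomputable section

namespace TimeMechanics

/-- Coordinate space: index `0` is the temporal coordinate, the indices `i.succ` are the spatial
coordinates. -/
abbrev Coord (n : ℕ) : Type := EuclideanSpace ℝ (Fin (n + 1))

/-- Partial derivative `∂_a F` at `y`. -/
def pd {n : ℕ} (a : Fin (n + 1)) (F : Coord n → ℝ) (y : Coord n) : ℝ :=
  fderiv ℝ F y (EuclideanSpace.single a 1)

section Bundle

variable {n : ℕ} {X : Type*} [TopologicalSpace X] [ChartedSpace (Coord n) X]

/-- Adapted bundle coordinates `(x⁰, xⁱ)`: smooth charts of `X` whose temporal coordinate is the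
projection `π : X → ℝ` up to an additive constant. -/
def IsBundleChart (π : X → ℝ) (e : OpenPartialHomeomorph X (Coord n)) : Prop :=
  e ∈ IsManifold.maximalAtlas (𝓡 (n + 1)) ∞ X ∧ ∃ s : ℝ, ∀ x ∈ e.source, e x 0 = π x + s

/-- `π : X → ℝ` is a fibration over the time axis: there are adapted coordinates around every
point. -/
def IsTimeFibration (π : X → ℝ) : Prop :=
  ∀ x : X, ∃ e : OpenPartialHomeomorph X (Coord n), IsBundleChart π e ∧ x ∈ e.source

/-- The components of a tangent vector in a chart. -/
def comp (e : OpenPartialHomeomorph X (Coord n)) (x : X) (v : TangentSpace (𝓡 (n + 1)) x) :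
    Fin (n + 1) → ℝ :=
  fun a => EuclideanSpace.proj (𝕜 := ℝ) a (mfderiv (𝓡 (n + 1)) (𝓡 (n + 1)) e x v)

/-- The first order jet manifold `J¹X`, identified with the affine subbundle `ẋ⁰ = 1` of `TX`. -/
def JetSpace (π : X → ℝ) : Type _ :=
  {p : TangentBundle (𝓡 (n + 1)) X //
    (mfderiv (𝓡 (n + 1)) 𝓘(ℝ, ℝ) π p.proj p.snd : ℝ) = 1}

/-- A quadratic Lagrangian `L = ½ m_ij x₀ⁱ x₀ʲ + k_i x₀ⁱ + f` on `J¹X` with a Riemannian mass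
tensor `m`. The functions `m_ij`, `k_i`, `f` of each bundle chart `e` (as functions on the
coordinate domain `e.target`) are determined by `L` through `eq_quadratic`. -/
structure QuadraticLagrangian (π : X → ℝ) where
  toFun : JetSpace (n := n) π → ℝ
  mass : OpenPartialHomeomorph X (Coord n) → Coord n → Matrix (Fin n) (Fin n) ℝ
  lin : OpenPartialHomeomorph X (Coord n) → Coord n → Fin n → ℝ
  pot : OpenPartialHomeomorph X (Coord n) → Coord n → ℝ
  mass_smooth : ∀ e, IsBundleChart π e → ∀ i j,
    ContDiffOn ℝ ∞ (fun y => mass e y i j) e.target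
  lin_smooth : ∀ e, IsBundleChart π e → ∀ i, ContDiffOn ℝ ∞ (fun y => lin e y i) e.target
  pot_smooth : ∀ e, IsBundleChart π e → ContDiffOn ℝ ∞ (pot e) e.target
  mass_posDef : ∀ e, IsBundleChart π e → ∀ y ∈ e.target, (mass e y).PosDef
  eq_quadratic : ∀ e, IsBundleChart π e → ∀ p : JetSpace (n := n) π, p.1.proj ∈ e.source →
    toFun p =
      (1 / 2) * ∑ i : Fin n, ∑ j : Fin n, mass e (e p.1.proj) i j *
          comp e p.1.proj p.1.snd i.succ * comp e p.1.proj p.1.snd j.succ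
        + ∑ i : Fin n, lin e (e p.1.proj) i * comp e p.1.proj p.1.snd i.succ
        + pot e (e p.1.proj)

/-- A reference frame: a connection `Γ = ∂₀ + Γⁱ ∂ᵢ` on `X → ℝ`, that is, a smooth vector field
with values in `J¹X`. -/
structure ReferenceFrame [IsManifold (𝓡 (n + 1)) ∞ X] (π : X → ℝ) where
  vec : (x : X) → TangentSpace (𝓡 (n + 1)) x
  smooth : ContMDiff (𝓡 (n + 1)) (𝓡 (n + 1)).tangent ∞
    (fun x => (⟨x, vec x⟩ : TangentBundle (𝓡 (n + 1)) X))
  time_eq_one : ∀ x, (mfderiv (𝓡 (n + 1)) 𝓘(ℝ, ℝ) π x (vec x) : ℝ) = 1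

namespace QuadraticLagrangian

variable {π : X → ℝ} (L : QuadraticLagrangian (n := n) π)
  (e : OpenPartialHomeomorph X (Coord n))

/-- The bilinear form `g₀₀ = -2f`, `g₀ᵢ = -kᵢ`, `gᵢⱼ = -mᵢⱼ`, so that `L = -½ g(ẋ, ẋ)` on
`ẋ⁰ = 1`. -/
def metric (a b : Fin (n + 1)) (y : Coord n) : ℝ :=
  Fin.cases (Fin.cases (-2 * L.pot e y) (fun j => -L.lin e y j) b)
    (fun i => Fin.cases (-L.lin e y i) (fun j => -L.mass e y i j) b) a

/-- `{a b c} = -½ (∂_a g_bc + ∂_c g_ba - ∂_b g_ac)`. -/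
def christoffel (a b c : Fin (n + 1)) (y : Coord n) : ℝ :=
  -(1 / 2) * (pd a (L.metric e b c) y + pd c (L.metric e b a) y - pd b (L.metric e a c) y)

/-- The linear connection `K_a^b_c` (`b` is the upper index): `K_a^0_c = 0` and
`K_a^i_c = (-m⁻¹)^{ik} {a k c}`. Geodesics satisfy `ẍ^b = K_a^b_c ẋ^a ẋ^c`, i.e. `K` is minus
the usual connection coefficients. -/
def conn (a b c : Fin (n + 1)) (y : Coord n) : ℝ :=
  Fin.cases 0
    (fun i => ∑ k : Fin n, (-(L.mass e y)⁻¹ i k) * L.christoffel e a k.succ c y) b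

/-- The curvature `R_{ab}^c_d` (`c` is the upper index) of the connection, with the sign
convention that goes with `conn`:
`R_{ab}^c_d = ∂_a K_b^c_d - ∂_b K_a^c_d + K_a^p_d K_b^c_p - K_b^p_d K_a^c_p`. -/
def curv (a b c d : Fin (n + 1)) (y : Coord n) : ℝ :=
  pd a (L.conn e b c d) y - pd b (L.conn e a c d) y +
    ∑ p : Fin (n + 1), (L.conn e a p d y * L.conn e b c p y - L.conn e b p d y * L.conn e a c p y)

/-- The components `ẋ^a` of the velocity of a curve `c`, defined on the interval `S`. -/
def vel (e : OpenPartialHomeomorph X (Coord n)) (c : ℝ → X) (S : Set ℝ) (t : ℝ)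
    (a : Fin (n + 1)) : ℝ :=
  derivWithin (fun s => e (c s) a) S t

/-- The covariant derivative `ẋ^a ∇_a w^b = dw^b/dt - K_a^b_d ẋ^a w^d` along the curve `c` of a
field with components `w`. -/
def covDeriv (c : ℝ → X) (S : Set ℝ) (w : ℝ → Fin (n + 1) → ℝ) (t : ℝ) (b : Fin (n + 1)) : ℝ :=
  derivWithin (fun s => w s b) S t -
    ∑ a : Fin (n + 1), ∑ d : Fin (n + 1), L.conn e a b d (e (c t)) * vel e c S t a * w t d

/-- `c` is a geodesic motion on the interval `J`: in bundle coordinates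
`ẋ⁰ = 1` and `ẍ^b = K_a^b_d ẋ^a ẋ^d`. -/
structure IsGeodesicMotion (c : ℝ → X) (J : Set ℝ) : Prop where
  contMDiffOn : ContMDiffOn 𝓘(ℝ, ℝ) (𝓡 (n + 1)) 2 c J
  time_eq_one : ∀ e : OpenPartialHomeomorph X (Coord n), IsBundleChart π e →
    ∀ t ∈ J, c t ∈ e.source → vel e c J t 0 = 1
  geodesic_eq : ∀ e : OpenPartialHomeomorph X (Coord n), IsBundleChart π e →
    ∀ t ∈ J, c t ∈ e.source → ∀ b : Fin (n + 1),
      derivWithin (fun s => vel e c J s b) J t =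
        ∑ a : Fin (n + 1), ∑ d : Fin (n + 1),
          L.conn e a b d (e (c t)) * vel e c J t a * vel e c J t d

/-- `u` is a Jacobi vector field along `c` on the interval `S`: it is of class `C²` and
`ẋ^d ẋ^b (∇_d ∇_b u^p - R_{ab}^p_d u^a) = 0` in bundle coordinates. -/
structure IsJacobiField (c : ℝ → X) (S : Set ℝ) (u : (t : ℝ) → TangentSpace (𝓡 (n + 1)) (c t)) :
    Prop where
  contDiffOn : ∀ e : OpenPartialHomeomorph X (Coord n), IsBundleChart π e → ∀ b : Fin (n + 1),
    ContDiffOn ℝ 2 (fun t => comp e (c t) (u t) b) (S ∩ c ⁻¹' e.source)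
  jacobi_eq : ∀ e : OpenPartialHomeomorph X (Coord n), IsBundleChart π e →
    ∀ t ∈ S, c t ∈ e.source → ∀ p : Fin (n + 1),
      L.covDeriv e c S (L.covDeriv e c S (fun s => comp e (c s) (u s))) t p =
        ∑ a : Fin (n + 1), ∑ b : Fin (n + 1), ∑ d : Fin (n + 1),
          L.curv e a b p d (e (c t)) * comp e (c t) (u t) a * vel e c S t b * vel e c S t d

/-- `c a` and `c b` are conjugate along `c`: there is a nonzero Jacobi field along the geodesic
segment `c|[a, b]` which vanishes at both ends. -/
def AreConjugate (c : ℝ → X) (a b : ℝ) : Prop :=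
  ∃ u : (t : ℝ) → TangentSpace (𝓡 (n + 1)) (c t),
    L.IsJacobiField c (Set.Icc a b) u ∧ u a = 0 ∧ u b = 0 ∧ ∃ t ∈ Set.Icc a b, u t ≠ 0

variable [IsManifold (𝓡 (n + 1)) ∞ X] (Γ : ReferenceFrame (n := n) π)

/-- The components at `x` of the auxiliary metric `ḡ` of the reference frame `Γ`: it is
`ḡ = -dx⁰ ⊗ dx⁰ - m_ij (dxⁱ - Γⁱ dx⁰) ⊗ (dxʲ - Γʲ dx⁰)`. In the coordinates of the frame, where
`Γⁱ = 0`, this is `ḡ₀₀ = -1`, `ḡ₀ᵢ = 0`, `ḡᵢⱼ = -mᵢⱼ`. -/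
def frameMetric (x : X) (a b : Fin (n + 1)) : ℝ :=
  Fin.cases
    (Fin.cases
      (-1 - ∑ i : Fin n, ∑ j : Fin n,
        L.mass e (e x) i j * comp e x (Γ.vec x) i.succ * comp e x (Γ.vec x) j.succ)
      (fun j => ∑ i : Fin n, L.mass e (e x) i j * comp e x (Γ.vec x) i.succ) b)
    (fun i => Fin.cases
      (∑ j : Fin n, L.mass e (e x) i j * comp e x (Γ.vec x) j.succ)
      (fun j => -L.mass e (e x) i j) b) a

/-- `R_{abpd} u^a u^p v^b v^d` at the point `x`, where `R_{abpd} = ḡ_{pq} R_{ab}^q_d`. -/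
def sectional (x : X) (u v : Fin (n + 1) → ℝ) : ℝ :=
  ∑ a : Fin (n + 1), ∑ b : Fin (n + 1), ∑ p : Fin (n + 1), ∑ d : Fin (n + 1),
    (∑ q : Fin (n + 1), L.frameMetric e Γ x p q * L.curv e a b q d (e x)) *
      u a * u p * v b * v d

/-- The sectional curvature `R_{abpd} u^a u^p ẋ^b ẋ^d` is nonpositive along the motion, for all
vectors `u` with `u⁰ = 0`. -/
def NonposSectionalAlong (c : ℝ → X) (J : Set ℝ) : Prop :=
  ∀ e : OpenPartialHomeomorph X (Coord n), IsBundleChart π e → ∀ t ∈ J, c t ∈ e.source →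
    ∀ u : Fin (n + 1) → ℝ, u 0 = 0 → L.sectional e Γ (c t) u (vel e c J t) ≤ 0

end QuadraticLagrangian

end Bundle

end TimeMechanics

end

/-! ### Calculus in one variable: convexity and a Leibniz rule. -/

namespace TimeMechanics

open Set Filter Topology

/-! Let `u` be a Jacobi field vanishing at `a` and `b`. Since `K_a^0_c = 0`, the curvature has no
component with upper index `0` (`curv_zero`), so the temporal Jacobi equation reads `(u⁰)'' = 0`. An
affine function with two zeros vanishes, hence `u` is vertical (`IsJacobiField.vertical`).

On vertical vectors the connection is compatible with the mass form `m` (`pd_mass`), so with `D` the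
covariant derivative along the motion, `m(u, u)'' = 2 m(Du, Du) + 2 m(u, D²u)`. By the Jacobi
equation `m(u, D²u)` is minus the sectional curvature term (`sectional_eq`), so the hypothesis makes
both summands nonnegative. Thus `m(u, u)` is convex and vanishes at both ends, so it is nonpositive;
positive definiteness of `m` forces `u = 0`.

The motion need not lie in one chart. For vertical `u`, `m(u, u)` is a second difference of `L`
along the fibre of the jet space (`massForm_eq_second_difference`), hence a function of `t` alone,
and convexity is checked locally. -/

/-- A function on `[a, b]` with nonnegative second derivative inside which vanishes at both ends is
nonpositive. -/
theorem nonpos_of_second_deriv_nonneg {a b : ℝ} {f : ℝ → ℝ} (hf : ContinuousOn f (Icc a b))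
    (ha : f a = 0) (hb : f b = 0)
    (h : ∀ t ∈ Ioo a b, ∃ (g : ℝ → ℝ) (r : ℝ),
      (∀ᶠ s in 𝓝 t, HasDerivAt f (g s) s) ∧ HasDerivAt g r t ∧ 0 ≤ r) :
    ∀ t ∈ Icc a b, f t ≤ 0 := by
  have key : ∀ t ∈ Ioo a b, ∃ r, HasDerivAt (deriv f) r t ∧ 0 ≤ r := by
    intro t ht
    obtain ⟨g, r, hg, hr, h0⟩ := h t ht
    refine ⟨r, hr.congr_of_eventuallyEq ?_, h0⟩
    filter_upwards [hg] with s hs using hs.deriv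
  have hconv : ConvexOn ℝ (Icc a b) f := by
    refine convexOn_of_deriv2_nonneg (convex_Icc a b) hf ?_ ?_ ?_ <;> rw [interior_Icc]
    · intro t ht
      obtain ⟨g, r, hg, -⟩ := h t ht
      exact hg.self_of_nhds.differentiableAt.differentiableWithinAt
    · intro t ht
      obtain ⟨r, hr, -⟩ := key t ht
      exact hr.differentiableAt.differentiableWithinAt
    · intro t ht
      obtain ⟨r, hr, h0⟩ := key t ht
      simpa [hr.deriv] using h0
  intro t ht
  have hab : a ≤ b := ht.1.trans ht.2
  have := hconv.le_on_segment (left_mem_Icc.2 hab) (right_mem_Icc.2 hab)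
    (by rwa [segment_eq_Icc hab] : t ∈ segment ℝ a b)
  simpa [ha, hb] using this

/-- Leibniz rule for a symmetric form along a curve, in terms of derivatives `D = d/dt - A` that
are compatible with the form. -/
theorem hasDerivAt_form {n : ℕ} {M : ℝ → Matrix (Fin n) (Fin n) ℝ} {U V : ℝ → Fin n → ℝ} {t : ℝ}
    {A : Matrix (Fin n) (Fin n) ℝ} {DU DV : Fin n → ℝ}
    (hM : ∀ i j, HasDerivAt (fun s => M s i j)
      (-(∑ k, M t i k * A k j + ∑ k, M t j k * A k i)) t)
    (hs : ∀ i j, M t i j = M t j i)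
    (hU : ∀ i, HasDerivAt (fun s => U s i) (DU i + ∑ k, A i k * U t k) t)
    (hV : ∀ i, HasDerivAt (fun s => V s i) (DV i + ∑ k, A i k * V t k) t) :
    HasDerivAt (fun s => ∑ i, ∑ j, M s i j * U s i * V s j)
      (∑ i, ∑ j, M t i j * DU i * V t j + ∑ i, ∑ j, M t i j * U t i * DV j) t := by
  have h := HasDerivAt.fun_sum (u := Finset.univ) fun i _ =>
    HasDerivAt.fun_sum (u := Finset.univ) fun j _ => ((hM i j).fun_mul (hU i)).fun_mul (hV j)
  refine h.congr_deriv ?_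
  -- The two halves of the derivative of `M` cancel the `A`-terms in the derivatives of `V` (`h1`)
  -- and, using the symmetry of `M`, of `U` (`h2`).
  have h1 : ∑ i, ∑ j, (∑ k, M t i k * A k j) * U t i * V t j =
      ∑ i, ∑ j, M t i j * U t i * (∑ k, A j k * V t k) := by
    refine Finset.sum_congr rfl fun i _ => ?_
    simp only [Finset.sum_mul, Finset.mul_sum]
    rw [Finset.sum_comm]
    exact Finset.sum_congr rfl fun j _ => Finset.sum_congr rfl fun k _ => by ring
  have h2 : ∑ i, ∑ j, (∑ k, M t j k * A k i) * U t i * V t j =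
      ∑ i, ∑ j, M t i j * (∑ k, A i k * U t k) * V t j := by
    rw [Finset.sum_comm, Finset.sum_comm (f := fun i j => M t i j * (∑ k, A i k * U t k) * V t j)]
    refine Finset.sum_congr rfl fun j _ => ?_
    simp only [Finset.sum_mul, Finset.mul_sum]
    rw [Finset.sum_comm]
    exact Finset.sum_congr rfl fun i _ => Finset.sum_congr rfl fun k _ => by rw [hs j i]; ring
  simp only [neg_mul, add_mul, mul_add, Finset.sum_add_distrib, Finset.sum_neg_distrib, h1, h2]
  ring

/-! ### Partial derivatives and smoothness of the inverse matrix. -/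

section Coordinates

variable {n : ℕ}

theorem contDiffAt_pd {F : Coord n → ℝ} {y : Coord n} (hF : ContDiffAt ℝ ∞ F y)
    (a : Fin (n + 1)) : ContDiffAt ℝ ∞ (pd a F) y :=
  (hF.fderiv_right (m := ∞) (by simp)).clm_apply contDiffAt_const

theorem pd_congr {F G : Coord n → ℝ} {y : Coord n} (h : F =ᶠ[𝓝 y] G) (a : Fin (n + 1)) :
    pd a F y = pd a G y := by
  rw [pd, pd, h.fderiv_eq]

theorem pd_neg (F : Coord n → ℝ) (y : Coord n) (a : Fin (n + 1)) :
    pd a (fun z => -F z) y = -pd a F y := by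
  simp [pd, fderiv_fun_neg]

theorem fderiv_eq_sum_pd (F : Coord n → ℝ) (y v : Coord n) :
    fderiv ℝ F y v = ∑ a, pd a F y * v a := by
  conv_lhs => rw [← (EuclideanSpace.basisFun (Fin (n + 1)) ℝ).sum_repr v]
  simp [pd, mul_comm]

theorem contDiffAt_det {m : ℕ} {M : Coord n → Matrix (Fin m) (Fin m) ℝ} {y : Coord n}
    (hM : ∀ i j, ContDiffAt ℝ ∞ (fun z => M z i j) y) :
    ContDiffAt ℝ ∞ (fun z => (M z).det) y := by
  simp only [Matrix.det_apply']
  exact ContDiffAt.sum fun σ _ => contDiffAt_const.mul (contDiffAt_prod fun i _ => hM _ _)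

/-- Cramer's rule: the entries are cofactor determinants divided by `det`. -/
theorem contDiffAt_matrix_inv {m : ℕ} {M : Coord n → Matrix (Fin m) (Fin m) ℝ} {y : Coord n}
    (hM : ∀ i j, ContDiffAt ℝ ∞ (fun z => M z i j) y) (h0 : (M y).det ≠ 0) (i j : Fin m) :
    ContDiffAt ℝ ∞ (fun z => (M z)⁻¹ i j) y := by
  simp only [Matrix.inv_def, Ring.inverse_eq_inv', Matrix.smul_apply, smul_eq_mul,
    Matrix.adjugate_apply]
  refine ((contDiffAt_det hM).inv h0).mul (contDiffAt_det fun k l => ?_)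
  by_cases hk : k = j
  · simpa [hk] using contDiffAt_const
  · simpa [Matrix.updateRow_ne hk] using hM k l

end Coordinates

/-! ### Tangent vectors in adapted charts. -/

section Bundle

variable {n : ℕ} {X : Type*} [TopologicalSpace X] [ChartedSpace (Coord n) X] {π : X → ℝ}
  {e : OpenPartialHomeomorph X (Coord n)}

theorem IsBundleChart.contMDiffAt (he : IsBundleChart π e) {x : X} (hx : x ∈ e.source) :
    ContMDiffAt (𝓡 (n + 1)) (𝓡 (n + 1)) ∞ e x :=
  (contMDiffOn_of_mem_maximalAtlas he.1).contMDiffAt (e.open_source.mem_nhds hx)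

theorem IsBundleChart.mdifferentiable (he : IsBundleChart π e) :
    e.MDifferentiable (𝓡 (n + 1)) (𝓡 (n + 1)) :=
  ⟨(contMDiffOn_of_mem_maximalAtlas he.1).mdifferentiableOn (by simp),
    (contMDiffOn_symm_of_mem_maximalAtlas he.1).mdifferentiableOn (by simp)⟩

/-- Since `x⁰` and `π` differ by a constant, `dx⁰ = dπ`; verticality is therefore independent of the
chart. -/
theorem IsBundleChart.comp_zero (he : IsBundleChart π e) {x : X} (hx : x ∈ e.source)
    (v : TangentSpace (𝓡 (n + 1)) x) :
    comp e x v 0 = (mfderiv (𝓡 (n + 1)) 𝓘(ℝ, ℝ) π x v : ℝ) := by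
  obtain ⟨s, hs⟩ := he.2
  have h1 : HasFDerivAt (fun y : Coord n => y 0 - s)
      (EuclideanSpace.proj (𝕜 := ℝ) (0 : Fin (n + 1))) (e x) :=
    ((EuclideanSpace.proj (𝕜 := ℝ) (0 : Fin (n + 1))).hasFDerivAt).sub_const s
  have h2 := (he.contMDiffAt hx).mdifferentiableAt (by simp) |>.hasMFDerivAt
  have h3 := HasMFDerivAt.comp x (HasFDerivAt.hasMFDerivAt h1) h2
  have h4 : π =ᶠ[𝓝 x] (fun y : Coord n => y 0 - s) ∘ e := by
    filter_upwards [e.open_source.mem_nhds hx] with z hz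
    simp [hs z hz]
  rw [(h3.congr_of_eventuallyEq h4).mfderiv]
  rfl

theorem IsBundleChart.eq_zero_of_comp_eq_zero (he : IsBundleChart π e) {x : X}
    (hx : x ∈ e.source) {v : TangentSpace (𝓡 (n + 1)) x} (hv : comp e x v = 0) : v = 0 := by
  apply he.mdifferentiable.mfderiv_injective hx
  rw [map_zero]
  exact PiLp.ext fun a => congrFun hv a

theorem comp_add (e : OpenPartialHomeomorph X (Coord n)) (x : X)
    (v w : TangentSpace (𝓡 (n + 1)) x) (a : Fin (n + 1)) :
    comp e x (v + w) a = comp e x v a + comp e x w a :=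
  congrArg (fun z : Coord n => z a) (map_add (mfderiv (𝓡 (n + 1)) (𝓡 (n + 1)) e x) v w)

theorem comp_sub (e : OpenPartialHomeomorph X (Coord n)) (x : X)
    (v w : TangentSpace (𝓡 (n + 1)) x) (a : Fin (n + 1)) :
    comp e x (v - w) a = comp e x v a - comp e x w a :=
  congrArg (fun z : Coord n => z a) (map_sub (mfderiv (𝓡 (n + 1)) (𝓡 (n + 1)) e x) v w)

theorem comp_fun_zero (e : OpenPartialHomeomorph X (Coord n)) (x : X) :
    comp e x (0 : TangentSpace (𝓡 (n + 1)) x) = 0 :=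
  funext fun a =>
    congrArg (fun z : Coord n => z a) (map_zero (mfderiv (𝓡 (n + 1)) (𝓡 (n + 1)) e x))

/-! ### The mass form, the connection and the curvature. -/

namespace QuadraticLagrangian

variable (L : QuadraticLagrangian (n := n) π)

/-- The mass form `m_ij uⁱ vʲ` in the chart `e`, at the coordinates `y`. -/
def massForm (e : OpenPartialHomeomorph X (Coord n)) (y : Coord n) (u v : Fin n → ℝ) : ℝ :=
  ∑ i, ∑ j, L.mass e y i j * u i * v j

theorem massForm_eq_dotProduct (e : OpenPartialHomeomorph X (Coord n)) (y : Coord n)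
    (u v : Fin n → ℝ) : L.massForm e y u v = u ⬝ᵥ (L.mass e y).mulVec v := by
  simp only [massForm, dotProduct, Matrix.mulVec, Finset.mul_sum]
  exact Finset.sum_congr rfl fun i _ => Finset.sum_congr rfl fun j _ => by ring

theorem massForm_nonneg (he : IsBundleChart π e) {y : Coord n} (hy : y ∈ e.target)
    (u : Fin n → ℝ) : 0 ≤ L.massForm e y u u := by
  rw [massForm_eq_dotProduct]
  simpa using (L.mass_posDef e he y hy).posSemidef.dotProduct_mulVec_nonneg u

theorem eq_zero_of_massForm_nonpos (he : IsBundleChart π e) {y : Coord n} (hy : y ∈ e.target)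
    {u : Fin n → ℝ} (h : L.massForm e y u u ≤ 0) : u = 0 := by
  by_contra hu
  have := (L.mass_posDef e he y hy).dotProduct_mulVec_pos hu
  rw [massForm_eq_dotProduct] at h
  simp at this
  linarith

theorem mass_symm (he : IsBundleChart π e) {y : Coord n} (hy : y ∈ e.target) (i j : Fin n) :
    L.mass e y i j = L.mass e y j i := by
  simpa using ((L.mass_posDef e he y hy).isHermitian.apply i j).symm

/-- On vertical vectors the mass form is the second difference of the Lagrangian. -/
theorem massForm_eq_second_difference (he : IsBundleChart π e) {x : X} (hx : x ∈ e.source)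
    (v u : TangentSpace (𝓡 (n + 1)) x)
    (hv : (mfderiv (𝓡 (n + 1)) 𝓘(ℝ, ℝ) π x v : ℝ) = 1)
    (hp : (mfderiv (𝓡 (n + 1)) 𝓘(ℝ, ℝ) π x (v + u) : ℝ) = 1)
    (hm : (mfderiv (𝓡 (n + 1)) 𝓘(ℝ, ℝ) π x (v - u) : ℝ) = 1) :
    L.massForm e (e x) (fun i => comp e x u i.succ) (fun i => comp e x u i.succ) =
      L.toFun ⟨⟨x, v + u⟩, hp⟩ + L.toFun ⟨⟨x, v - u⟩, hm⟩ - 2 * L.toFun ⟨⟨x, v⟩, hv⟩ := by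
  rw [L.eq_quadratic e he ⟨⟨x, v + u⟩, hp⟩ hx, L.eq_quadratic e he ⟨⟨x, v - u⟩, hm⟩ hx,
    L.eq_quadratic e he ⟨⟨x, v⟩, hv⟩ hx]
  -- The terms in `k` and `f` and the cross terms `m(v, u)` cancel, leaving `½ m(u, u)` twice.
  simp only [comp_add, comp_sub, massForm, mul_add, mul_sub, add_mul, sub_mul,
    Finset.sum_add_distrib, Finset.sum_sub_distrib]
  ring

/-- The mass form of a vertical vector does not depend on the chart. -/
theorem massForm_eq_of_vertical (he : IsBundleChart π e)
    {e' : OpenPartialHomeomorph X (Coord n)} (he' : IsBundleChart π e') {x : X}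
    (hx : x ∈ e.source) (hx' : x ∈ e'.source) (v u : TangentSpace (𝓡 (n + 1)) x)
    (hv : (mfderiv (𝓡 (n + 1)) 𝓘(ℝ, ℝ) π x v : ℝ) = 1)
    (hu : (mfderiv (𝓡 (n + 1)) 𝓘(ℝ, ℝ) π x u : ℝ) = 0) :
    L.massForm e (e x) (fun i => comp e x u i.succ) (fun i => comp e x u i.succ) =
      L.massForm e' (e' x) (fun i => comp e' x u i.succ) (fun i => comp e' x u i.succ) := by
  -- Adding a vertical vector to `v`, or subtracting it, stays in the jet space `dπ = 1`.
  have hp : (mfderiv (𝓡 (n + 1)) 𝓘(ℝ, ℝ) π x (v + u) : ℝ) = 1 := by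
    rw [map_add]; exact (congrArg₂ (· + ·) hv hu).trans (add_zero 1)
  have hm : (mfderiv (𝓡 (n + 1)) 𝓘(ℝ, ℝ) π x (v - u) : ℝ) = 1 := by
    rw [map_sub]; exact (congrArg₂ (· - ·) hv hu).trans (sub_zero 1)
  rw [L.massForm_eq_second_difference he hx v u hv hp hm,
    L.massForm_eq_second_difference he' hx' v u hv hp hm]

theorem contDiffAt_mass (he : IsBundleChart π e) {y : Coord n} (hy : y ∈ e.target)
    (i j : Fin n) : ContDiffAt ℝ ∞ (fun z => L.mass e z i j) y :=
  (L.mass_smooth e he i j).contDiffAt (e.open_target.mem_nhds hy)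

theorem contDiffAt_metric (he : IsBundleChart π e) {y : Coord n} (hy : y ∈ e.target)
    (a b : Fin (n + 1)) : ContDiffAt ℝ ∞ (L.metric e a b) y := by
  have hlin (i : Fin n) : ContDiffAt ℝ ∞ (fun z => L.lin e z i) y :=
    (L.lin_smooth e he i).contDiffAt (e.open_target.mem_nhds hy)
  unfold metric
  refine Fin.cases (Fin.cases ?_ (fun j => ?_) b) (fun i => Fin.cases ?_ (fun j => ?_) b) a
  · exact (contDiffAt_const (c := (-2 : ℝ))).mul ((L.pot_smooth e he).contDiffAt (e.open_target.mem_nhds hy))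
  · exact (hlin j).neg
  · exact (hlin i).neg
  · exact (L.contDiffAt_mass he hy i j).neg

theorem contDiffAt_conn (he : IsBundleChart π e) {y : Coord n} (hy : y ∈ e.target)
    (a b c : Fin (n + 1)) : ContDiffAt ℝ ∞ (L.conn e a b c) y := by
  unfold conn
  refine Fin.cases ?_ (fun i => ?_) b
  · exact contDiffAt_const
  · change ContDiffAt ℝ ∞ (fun y => ∑ k : Fin n,
      (-(L.mass e y)⁻¹ i k) * L.christoffel e a k.succ c y) y
    refine ContDiffAt.sum fun k _ => ?_
    refine (contDiffAt_matrix_inv (fun i j => L.contDiffAt_mass he hy i j)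
      (L.mass_posDef e he y hy).det_pos.ne' i k).neg.mul ?_
    have hpd (p q r : Fin (n + 1)) := contDiffAt_pd (L.contDiffAt_metric he hy q r) p
    exact contDiffAt_const.mul (((hpd _ _ _).add (hpd _ _ _)).sub (hpd _ _ _))

/-- Lowering the upper index with `m` cancels the `m⁻¹` in the definition of the connection. -/
theorem sum_mass_mul_conn (he : IsBundleChart π e) {y : Coord n} (hy : y ∈ e.target)
    (a c : Fin (n + 1)) (i : Fin n) :
    ∑ k, L.mass e y i k * L.conn e a k.succ c y = -L.christoffel e a i.succ c y := by
  have hu : IsUnit (L.mass e y).det := (L.mass_posDef e he y hy).det_pos.ne'.isUnit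
  have h : (L.mass e y).mulVec ((L.mass e y)⁻¹.mulVec fun k => L.christoffel e a k.succ c y) i =
      L.christoffel e a i.succ c y := by
    rw [Matrix.mulVec_mulVec, Matrix.mul_nonsing_inv _ hu, Matrix.one_mulVec]
  rw [← h]
  simp [Matrix.mulVec, dotProduct, conn]

/-- The connection preserves the mass form on vertical vectors. -/
theorem pd_mass (he : IsBundleChart π e) {y : Coord n} (hy : y ∈ e.target)
    (a : Fin (n + 1)) (i j : Fin n) :
    pd a (fun z => L.mass e z i j) y =
      -(∑ k, L.mass e y i k * L.conn e a k.succ j.succ y +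
        ∑ k, L.mass e y j k * L.conn e a k.succ i.succ y) := by
  -- The symmetry of `m` is known only on the chart domain; that is enough, as `pd` sees only the
  -- germ. Then `{a i j} + {a j i} = -∂_a g_ij = ∂_a m_ij`, the other derivatives cancelling in
  -- pairs.
  have hsymm (p q : Fin (n + 1)) : L.metric e p q =ᶠ[𝓝 y] L.metric e q p := by
    filter_upwards [e.open_target.mem_nhds hy] with z hz
    refine Fin.cases (Fin.cases rfl (fun j => rfl) q)
      (fun i => Fin.cases rfl (fun j => ?_) q) p
    simp [metric, L.mass_symm he hz i j]
  have hm : pd a (L.metric e i.succ j.succ) y = -pd a (fun z => L.mass e z i j) y :=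
    pd_neg _ _ _
  rw [L.sum_mass_mul_conn he hy, L.sum_mass_mul_conn he hy, christoffel, christoffel,
    pd_congr (hsymm j.succ i.succ) a, pd_congr (hsymm j.succ a) i.succ,
    pd_congr (hsymm i.succ a) j.succ, hm]
  ring

theorem conn_zero (a c : Fin (n + 1)) : L.conn e a 0 c = fun _ => 0 := rfl

theorem curv_zero (a b d : Fin (n + 1)) (y : Coord n) : L.curv e a b 0 d y = 0 := by
  simp [curv, conn_zero, pd]

/-- For `u⁰ = 0` and no curvature component with upper index `0`, only the block `ḡᵢⱼ = -mᵢⱼ`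
contributes, so the frame drops out. -/
theorem sectional_eq [IsManifold (𝓡 (n + 1)) ∞ X] (Γ : ReferenceFrame (n := n) π)
    {x : X} {u : Fin (n + 1) → ℝ} (hu : u 0 = 0)
    (v : Fin (n + 1) → ℝ) :
    L.sectional e Γ x u v = -L.massForm e (e x) (fun i => u i.succ) (fun i =>
      ∑ a, ∑ b, ∑ d, L.curv e a b i.succ d (e x) * u a * v b * v d) := by
  have h1 (a b d : Fin (n + 1)) (p : Fin n) :
      ∑ q, L.frameMetric e Γ x p.succ q * L.curv e a b q d (e x) =
      -∑ j, L.mass e (e x) p j * L.curv e a b j.succ d (e x) := by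
    simp [Fin.sum_univ_succ, curv_zero, frameMetric]
  unfold sectional massForm
  simp only [Fin.sum_univ_succ (n := n) (f := fun p : Fin (n + 1) => ∑ d, _ * u p * _ * _),
    hu, mul_zero, zero_mul, Finset.sum_const_zero, zero_add, h1]
  simp only [Finset.mul_sum, Finset.sum_mul, neg_mul, Finset.sum_neg_distrib]
  congr 1
  have : ∀ F : Fin (n+1) → Fin (n+1) → Fin n → Fin (n+1) → Fin n → ℝ,
      ∑ a, ∑ b, ∑ p, ∑ d, ∑ j, F a b p d j = ∑ p, ∑ j, ∑ a, ∑ b, ∑ d, F a b p d j := by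
    intro F
    calc _ = ∑ a, ∑ p, ∑ b, ∑ j, ∑ d, F a b p d j :=
          Finset.sum_congr rfl fun a _ => by
            rw [Finset.sum_comm]
            exact Finset.sum_congr rfl fun p _ => Finset.sum_congr rfl fun b _ => Finset.sum_comm
      _ = ∑ p, ∑ a, ∑ j, ∑ b, ∑ d, F a b p d j := by
          rw [Finset.sum_comm]
          exact Finset.sum_congr rfl fun p _ => Finset.sum_congr rfl fun a _ => Finset.sum_comm
      _ = _ := Finset.sum_congr rfl fun p _ => Finset.sum_comm
  rw [this]
  refine Finset.sum_congr rfl fun p _ => Finset.sum_congr rfl fun j _ => Finset.sum_congr rfl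
    fun a _ => Finset.sum_congr rfl fun b _ => Finset.sum_congr rfl fun d _ => by ring

end QuadraticLagrangian

end Bundle

end TimeMechanics

namespace TimeMechanics

open Set Filter Topology

theorem QuadraticLagrangian.vel_eq_deriv {n : ℕ} {X : Type*} [TopologicalSpace X]
    {e : OpenPartialHomeomorph X (Coord n)} {c : ℝ → X} {S : Set ℝ} {t : ℝ} (hS : S ∈ 𝓝 t)
    (p : Fin (n + 1)) : vel e c S t p = deriv (fun s => e (c s) p) t :=
  derivWithin_of_mem_nhds hS

/-! ### Covariant differentiation along a curve. -/

section Bundle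

variable {n : ℕ} {X : Type*} [TopologicalSpace X] [ChartedSpace (Coord n) X] {π : X → ℝ}
  {e : OpenPartialHomeomorph X (Coord n)}

namespace QuadraticLagrangian

variable (L : QuadraticLagrangian (n := n) π) {c : ℝ → X} {J : Set ℝ} {a b t : ℝ}
  {u : (t : ℝ) → TangentSpace (𝓡 (n + 1)) (c t)}

theorem contDiffAt_coord (hc : ContMDiffOn 𝓘(ℝ, ℝ) (𝓡 (n + 1)) 2 c J) (hJ : J ∈ 𝓝 t)
    (he : IsBundleChart π e) (hx : c t ∈ e.source) : ContDiffAt ℝ 2 (fun s => e (c s)) t := by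
  rw [← contMDiffAt_iff_contDiffAt]
  exact ((he.contMDiffAt hx).of_le (by norm_cast)).comp t (hc.contMDiffAt hJ)

theorem contDiffAt_coord_apply {y : ℝ → Coord n} (hy : ContDiffAt ℝ 2 y t) (p : Fin (n + 1)) :
    ContDiffAt ℝ 2 (fun s => y s p) t :=
  (EuclideanSpace.proj (𝕜 := ℝ) p).contDiff.contDiffAt.comp t hy

theorem eventually_mem_source (hc : ContMDiffOn 𝓘(ℝ, ℝ) (𝓡 (n + 1)) 2 c J) (hJ : J ∈ 𝓝 t)
    (hx : c t ∈ e.source) : ∀ᶠ s in 𝓝 t, c s ∈ e.source :=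
  (hc.contMDiffAt hJ).continuousAt.preimage_mem_nhds (e.open_source.mem_nhds hx)

theorem differentiableAt_deriv {g : ℝ → ℝ} (hg : ContDiffAt ℝ 2 g t) :
    DifferentiableAt ℝ (deriv g) t := by
  have h : ContDiffAt ℝ 1 (fderiv ℝ g) t := hg.fderiv_right (by norm_num)
  exact
    (h.differentiableAt (by norm_num)).clm_apply (differentiableAt_const (1 : ℝ))

theorem hasDerivAt_covDeriv {S : Set ℝ} (hS : S ∈ 𝓝 t) {w : ℝ → Fin (n + 1) → ℝ}
    {p : Fin (n + 1)} (hw : DifferentiableAt ℝ (fun s => w s p) t) :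
    HasDerivAt (fun s => w s p) (L.covDeriv e c S w t p +
      ∑ a, ∑ d, L.conn e a p d (e (c t)) * vel e c S t a * w t d) t := by
  rw [covDeriv, derivWithin_of_mem_nhds hS, sub_add_cancel]
  exact hw.hasDerivAt

theorem covDeriv_zero {S : Set ℝ} (w : ℝ → Fin (n + 1) → ℝ) :
    L.covDeriv e c S w t 0 = derivWithin (fun s => w s 0) S t := by
  simp [covDeriv, conn_zero]

/-- The matrix `K_a^i_k ẋ^a` of the connection along a curve, on vertical vectors. -/
noncomputable def connAlong (e : OpenPartialHomeomorph X (Coord n)) (c : ℝ → X) (S : Set ℝ) (t : ℝ) :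
    Matrix (Fin n) (Fin n) ℝ :=
  fun i k => ∑ a, L.conn e a i.succ k.succ (e (c t)) * vel e c S t a

/-- At a point where `w⁰ = 0` only the spatial block of the connection acts, which puts the
derivative in the form required by `hasDerivAt_form`. -/
theorem hasDerivAt_covDeriv_vertical {S : Set ℝ} (hS : S ∈ 𝓝 t) {w : ℝ → Fin (n + 1) → ℝ}
    (i : Fin n) (hw : DifferentiableAt ℝ (fun s => w s i.succ) t) (h0 : w t 0 = 0) :
    HasDerivAt (fun s => w s i.succ) (L.covDeriv e c S w t i.succ +
      ∑ k : Fin n, L.connAlong e c S t i k * w t k.succ) t := by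
  convert L.hasDerivAt_covDeriv hS hw using 2
  rw [Finset.sum_comm]
  simp [Fin.sum_univ_succ (n := n), h0, connAlong, Finset.sum_mul, add_mul, Finset.sum_add_distrib]

theorem differentiableAt_covDeriv {S : Set ℝ} (hS : S ∈ 𝓝 t) (he : IsBundleChart π e)
    (hx : c t ∈ e.source) (hy : ContDiffAt ℝ 2 (fun s => e (c s)) t)
    {w : ℝ → Fin (n + 1) → ℝ} (hw : ∀ p, ContDiffAt ℝ 2 (fun s => w s p) t) (p : Fin (n + 1)) :
    DifferentiableAt ℝ (fun s => L.covDeriv e c S w s p) t := by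
  have hev : ∀ᶠ s in 𝓝 t, S ∈ 𝓝 s := eventually_mem_nhds_iff.2 hS
  have hd {g : ℝ → ℝ} (hg : ContDiffAt ℝ 2 g t) :
      DifferentiableAt ℝ (fun s => derivWithin g S s) t := by
    refine (differentiableAt_deriv hg).congr_of_eventuallyEq ?_
    filter_upwards [hev] with s hs using derivWithin_of_mem_nhds hs
  refine (hd (hw p)).fun_sub (DifferentiableAt.fun_sum fun a _ => DifferentiableAt.fun_sum
    fun d _ => ?_)
  refine (DifferentiableAt.fun_mul ?_ (hd (contDiffAt_coord_apply hy a))).fun_mul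
    ((hw d).differentiableAt (by norm_num))
  exact DifferentiableAt.comp (g := L.conn e a p d) (f := fun s => e (c s)) t
    ((L.contDiffAt_conn he (e.map_source hx) a p d).differentiableAt (by simp))
    (hy.differentiableAt (by norm_num))

/-- The chain rule contracts `pd_mass` with the velocity. -/
theorem hasDerivAt_mass {S : Set ℝ} (hS : S ∈ 𝓝 t) (he : IsBundleChart π e)
    (hx : c t ∈ e.source) (hy : DifferentiableAt ℝ (fun s => e (c s)) t) (i j : Fin n) :
    HasDerivAt (fun s => L.mass e (e (c s)) i j)
      (-(∑ k, L.mass e (e (c t)) i k * L.connAlong e c S t k j +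
        ∑ k, L.mass e (e (c t)) j k * L.connAlong e c S t k i)) t := by
  have h := ((L.contDiffAt_mass he (e.map_source hx) i j).differentiableAt
    (by simp)).hasFDerivAt.comp_hasDerivAt t hy.hasDerivAt
  refine h.congr_deriv ?_
  have hv (p : Fin (n + 1)) : deriv (fun s => e (c s)) t p = vel e c S t p := by
    rw [vel_eq_deriv hS]
    exact (((EuclideanSpace.proj (𝕜 := ℝ) p).hasFDerivAt.comp_hasDerivAt t
      hy.hasDerivAt).deriv).symm
  rw [fderiv_eq_sum_pd]
  simp only [hv, L.pd_mass he (e.map_source hx), connAlong, Finset.mul_sum, neg_mul, add_mul,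
    Finset.sum_mul, Finset.sum_neg_distrib, Finset.sum_add_distrib]
  congr 2 <;> rw [Finset.sum_comm] <;>
    exact Finset.sum_congr rfl fun k _ => Finset.sum_congr rfl fun a _ => by ring

/-- The covariant derivative along a curve is a derivation of the mass form on vertical fields. -/
theorem hasDerivAt_massForm {S : Set ℝ} (hS : S ∈ 𝓝 t) (he : IsBundleChart π e)
    (hx : c t ∈ e.source) (hy : DifferentiableAt ℝ (fun s => e (c s)) t)
    {v w : ℝ → Fin (n + 1) → ℝ} (hv : ∀ i : Fin n, DifferentiableAt ℝ (fun s => v s i.succ) t)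
    (hw : ∀ i : Fin n, DifferentiableAt ℝ (fun s => w s i.succ) t) (hv0 : v t 0 = 0)
    (hw0 : w t 0 = 0) :
    HasDerivAt
      (fun s => L.massForm e (e (c s)) (fun i => v s i.succ) (fun i => w s i.succ))
      (L.massForm e (e (c t)) (fun i => L.covDeriv e c S v t i.succ) (fun i => w t i.succ) +
        L.massForm e (e (c t)) (fun i => v t i.succ) (fun i => L.covDeriv e c S w t i.succ)) t :=
  hasDerivAt_form (M := fun s => L.mass e (e (c s)))
    (U := fun s i => v s i.succ) (V := fun s i => w s i.succ)
    (L.hasDerivAt_mass hS he hx hy) (L.mass_symm he (e.map_source hx))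
    (fun i => L.hasDerivAt_covDeriv_vertical hS i (hv i) hv0)
    (fun i => L.hasDerivAt_covDeriv_vertical hS i (hw i) hw0)

/-! ### Jacobi fields: verticality and convexity. -/

namespace IsJacobiField

variable {L}

theorem contDiffAt_comp (hu : L.IsJacobiField c (Icc a b) u)
    (hc : ContMDiffOn 𝓘(ℝ, ℝ) (𝓡 (n + 1)) 2 c (Icc a b)) (ht : t ∈ Ioo a b)
    (he : IsBundleChart π e) (hx : c t ∈ e.source) (p : Fin (n + 1)) :
    ContDiffAt ℝ 2 (fun s => comp e (c s) (u s) p) t :=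
  (hu.contDiffOn e he p).contDiffAt (inter_mem (Icc_mem_nhds ht.1 ht.2)
    (eventually_mem_source hc (Icc_mem_nhds ht.1 ht.2) hx))

theorem continuousWithinAt_comp (hu : L.IsJacobiField c (Icc a b) u)
    (hc : ContinuousOn c (Icc a b)) (ht : t ∈ Icc a b)
    (he : IsBundleChart π e) (hx : c t ∈ e.source) (p : Fin (n + 1)) :
    ContinuousWithinAt (fun s => comp e (c s) (u s) p) (Icc a b) t := by
  refine ((hu.contDiffOn e he p).continuousOn t ⟨ht, hx⟩).mono_of_mem_nhdsWithin ?_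
  exact inter_mem self_mem_nhdsWithin
    ((hc t ht).preimage_mem_nhdsWithin (e.open_source.mem_nhds hx))

/-- A Jacobi field which vanishes at both ends is vertical. -/
theorem vertical (hπ : IsTimeFibration (n := n) π) (hu : L.IsJacobiField c (Icc a b) u)
    (hc : ContMDiffOn 𝓘(ℝ, ℝ) (𝓡 (n + 1)) 2 c (Icc a b)) (hua : u a = 0) (hub : u b = 0) :
    ∀ t ∈ Icc a b, (mfderiv (𝓡 (n + 1)) 𝓘(ℝ, ℝ) π (c t) (u t) : ℝ) = 0 := by
  let f : ℝ → ℝ := fun t => (mfderiv (𝓡 (n + 1)) 𝓘(ℝ, ℝ) π (c t) (u t) : ℝ)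
  have hcont : ContinuousOn f (Icc a b) := by
    intro t ht
    obtain ⟨e, he, hx⟩ := hπ (c t)
    refine (hu.continuousWithinAt_comp hc.continuousOn ht he hx 0).congr_of_eventuallyEq ?_
      (he.comp_zero hx _).symm
    filter_upwards [(hc.continuousOn t ht).preimage_mem_nhdsWithin (e.open_source.mem_nhds hx)]
      with s hs using (he.comp_zero hs _).symm
  have h0 {s : ℝ} (h : u s = 0) : f s = 0 := by
    change (mfderiv (𝓡 (n + 1)) 𝓘(ℝ, ℝ) π (c s) (u s) : ℝ) = 0
    rw [h]; exact map_zero _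
  have hder : ∀ t ∈ Ioo a b, ∃ g : ℝ → ℝ,
      (∀ᶠ s in 𝓝 t, HasDerivAt f (g s) s) ∧ HasDerivAt g 0 t := by
    intro t ht
    obtain ⟨e, he, hx⟩ := hπ (c t)
    have hS : Icc a b ∈ 𝓝 t := Icc_mem_nhds ht.1 ht.2
    let w : ℝ → Fin (n + 1) → ℝ := fun s => comp e (c s) (u s)
    have hw (p) : ContDiffAt ℝ 2 (fun s => w s p) t := hu.contDiffAt_comp hc ht he hx p
    have hfw : f =ᶠ[𝓝 t] fun s => w s 0 := by
      filter_upwards [eventually_mem_source hc hS hx] with s hs using (he.comp_zero hs _).symm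
    -- In the temporal component the covariant derivative is the ordinary one, so `g` is `(u⁰)'`.
    refine ⟨fun s => L.covDeriv e c (Icc a b) w s 0, ?_, ?_⟩
    · filter_upwards [hfw.eventuallyEq_nhds, eventually_mem_nhds_iff.2 hS,
        (hw 0).eventually (by simp)] with s hs hSs hws
      have := L.hasDerivAt_covDeriv (e := e) (c := c) hSs (hws.differentiableAt (by norm_num))
      simp only [conn_zero, zero_mul, Finset.sum_const_zero, add_zero] at this
      exact this.congr_of_eventuallyEq hs
    · have := L.hasDerivAt_covDeriv (e := e) (c := c) hS
        (L.differentiableAt_covDeriv hS he hx (contDiffAt_coord hc hS he hx) hw 0)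
      rw [hu.jacobi_eq e he t (Ioo_subset_Icc_self ht) hx 0] at this
      simpa [conn_zero, curv_zero] using this
  intro t ht
  -- With zero second derivative, both `f` and `-f` fall under the convexity lemma.
  refine le_antisymm (α := ℝ) ?_ (neg_nonpos.1 ?_)
  · refine nonpos_of_second_deriv_nonneg hcont (h0 hua) (h0 hub) (fun s hs => ?_) t ht
    obtain ⟨g, h1, h2⟩ := hder s hs
    exact ⟨g, 0, h1, h2, le_rfl⟩
  · refine nonpos_of_second_deriv_nonneg (f := fun s => -f s) hcont.neg (by simp [h0 hua])
      (by simp [h0 hub]) (fun s hs => ?_) t ht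
    obtain ⟨g, h1, h2⟩ := hder s hs
    exact ⟨fun s => -g s, -0, h1.mono fun r hr => hr.fun_neg, h2.fun_neg, by simp⟩

end IsJacobiField

/-- The second derivative of `m(u, u)` along a vertical Jacobi field is nonnegative. -/
theorem IsJacobiField.exists_second_deriv_massForm [IsManifold (𝓡 (n + 1)) ∞ X]
    {L : QuadraticLagrangian (n := n) π} {Γ : ReferenceFrame (n := n) π}
    (hu : L.IsJacobiField c (Icc a b) u)
    (hc : ContMDiffOn 𝓘(ℝ, ℝ) (𝓡 (n + 1)) 2 c (Icc a b)) (hR : L.NonposSectionalAlong Γ c J)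
    (hJ : Icc a b ⊆ J) (he : IsBundleChart π e) (ht : t ∈ Ioo a b) (hx : c t ∈ e.source)
    (hvert : ∀ s ∈ Icc a b, (mfderiv (𝓡 (n + 1)) 𝓘(ℝ, ℝ) π (c s) (u s) : ℝ) = 0) :
    ∃ (g : ℝ → ℝ) (r : ℝ),
      (∀ᶠ s in 𝓝 t, HasDerivAt (fun s => L.massForm e (e (c s))
        (fun i => comp e (c s) (u s) i.succ) (fun i => comp e (c s) (u s) i.succ)) (g s) s) ∧
      HasDerivAt g r t ∧ 0 ≤ r := by
  have hS : Icc a b ∈ 𝓝 t := Icc_mem_nhds ht.1 ht.2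
  let w : ℝ → Fin (n + 1) → ℝ := fun s => comp e (c s) (u s)
  let Dw : ℝ → Fin (n + 1) → ℝ := L.covDeriv e c (Icc a b) w
  have hw (p) : ContDiffAt ℝ 2 (fun s => w s p) t := hu.contDiffAt_comp hc ht he hx p
  have hy := contDiffAt_coord hc hS he hx
  have hDw (p) : DifferentiableAt ℝ (fun s => Dw s p) t :=
    L.differentiableAt_covDeriv hS he hx hy hw p
  have hw0 : ∀ᶠ s in 𝓝 t, w s 0 = 0 := by
    filter_upwards [eventually_mem_source hc hS hx, hS] with s hs hsS
    exact (he.comp_zero hs _).trans (hvert s hsS)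
  have hDw0 : Dw t 0 = 0 := by
    have h : (fun s => w s 0) =ᶠ[𝓝 t] fun _ => 0 := hw0
    simp only [Dw]
    rw [covDeriv_zero, derivWithin_of_mem_nhds hS, h.deriv_eq, deriv_const]
  have hwd (i : Fin n) : DifferentiableAt ℝ (fun s => w s i.succ) t :=
    (hw i.succ).differentiableAt (by norm_num)
  have hyd := hy.differentiableAt (by norm_num)
  -- The first derivative is kept as two unsymmetrised terms, so that the Leibniz rule applies to
  -- each; it requires `Dw` to be vertical at `t` as well.
  refine ⟨fun s => L.massForm e (e (c s)) (fun i => Dw s i.succ) (fun i => w s i.succ) +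
    L.massForm e (e (c s)) (fun i => w s i.succ) (fun i => Dw s i.succ), _, ?_,
    (L.hasDerivAt_massForm hS he hx hyd (fun i => hDw i.succ) hwd hDw0 hw0.self_of_nhds).add
    (L.hasDerivAt_massForm hS he hx hyd hwd (fun i => hDw i.succ) hw0.self_of_nhds hDw0), ?_⟩
  · have hwe : ∀ᶠ s in 𝓝 t, ∀ p, ContDiffAt ℝ 2 (fun s => w s p) s :=
      eventually_all.2 fun p => (hw p).eventually (by simp)
    filter_upwards [hwe, hy.eventually (by simp), eventually_mem_nhds_iff.2 hS, hw0,
      eventually_mem_source hc hS hx] with s hws hys hSs hs0 hxs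
    have hwd' (i : Fin n) : DifferentiableAt ℝ (fun s => w s i.succ) s :=
      (hws i.succ).differentiableAt (by norm_num)
    exact L.hasDerivAt_massForm hSs he hxs (hys.differentiableAt (by norm_num)) hwd' hwd' hs0 hs0
  · have hJt : J ∈ 𝓝 t := mem_of_superset hS hJ
    have hsec := hR e he t (hJ (Ioo_subset_Icc_self ht)) hx (w t) hw0.self_of_nhds
    rw [L.sectional_eq Γ hw0.self_of_nhds] at hsec
    have hjac : (fun i : Fin n => L.covDeriv e c (Icc a b) Dw t i.succ) = fun i : Fin n =>
        ∑ a, ∑ b, ∑ d, L.curv e a b i.succ d (e (c t)) * w t a * vel e c J t b * vel e c J t d := by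
      funext i
      -- The curvature hypothesis uses velocities within `J`, the Jacobi equation within `[a, b]`;
      -- at an interior point both are the ordinary derivative.
      simp only [vel_eq_deriv hJt]
      simpa only [vel_eq_deriv hS] using hu.jacobi_eq e he t (Ioo_subset_Icc_self ht) hx i.succ
    have hsymm (v z : Fin n → ℝ) : L.massForm e (e (c t)) v z = L.massForm e (e (c t)) z v := by
      unfold massForm
      rw [Finset.sum_comm]
      refine Finset.sum_congr rfl fun i _ => Finset.sum_congr rfl fun j _ => ?_
      rw [L.mass_symm he (e.map_source hx) j i]
      ring
    have hpos := L.massForm_nonneg he (e.map_source hx) (fun i => Dw t i.succ)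
    -- Now the second derivative is `2 m(w, D²w) + 2 m(Dw, Dw)`, and `hsec` says that `m(w, D²w) ≥
    -- 0`.
    rw [hsymm (fun i => L.covDeriv e c (Icc a b) Dw t i.succ), hjac]
    linarith

end QuadraticLagrangian

end Bundle

end TimeMechanics

/-! ### Gluing over the charts and conclusion. -/

open Set Filter Topology in
theorem mainTheorem8 {n : ℕ} {X : Type*} [TopologicalSpace X]
    [ChartedSpace (EuclideanSpace ℝ (Fin (n + 1))) X] [IsManifold (𝓡 (n + 1)) ∞ X]
    (π : X → ℝ) (hπ : TimeMechanics.IsTimeFibration (n := n) π)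
    (L : TimeMechanics.QuadraticLagrangian (n := n) π)
    (Γ : TimeMechanics.ReferenceFrame (n := n) π)
    (c : ℝ → X) (J : Set ℝ) (hJ : J.OrdConnected) (hc : L.IsGeodesicMotion c J)
    (hR : L.NonposSectionalAlong Γ c J) :
    ∀ a ∈ J, ∀ b ∈ J, a < b → ¬ L.AreConjugate c a b := by
  rintro a ha b hb - ⟨u, hu, hua, hub, t₀, ht₀, hne⟩
  have hsub : Icc a b ⊆ J := hJ.out ha hb
  have hcC : ContMDiffOn 𝓘(ℝ, ℝ) (𝓡 (n + 1)) 2 c (Icc a b) := hc.contMDiffOn.mono hsub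
  have hvert := hu.vertical hπ hcC hua hub
  choose chart hchart hmem using hπ
  let F : OpenPartialHomeomorph X (TimeMechanics.Coord n) → ℝ → ℝ := fun e s =>
    L.massForm e (e (c s)) (fun i => TimeMechanics.comp e (c s) (u s) i.succ)
      (fun i => TimeMechanics.comp e (c s) (u s) i.succ)
  -- The chart jumps with `s`, but by `hfF` any adapted chart gives the same value; the frame vector
  -- supplies the base point `v` of the second difference.
  let f : ℝ → ℝ := fun s => F (chart (c s)) s
  have hfF {e} (he : TimeMechanics.IsBundleChart π e) {s : ℝ} (hs : s ∈ Icc a b)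
      (hx : c s ∈ e.source) : f s = F e s :=
    L.massForm_eq_of_vertical (hchart _) he (hmem _) hx (Γ.vec (c s)) (u s) (Γ.time_eq_one _)
      (hvert s hs)
  have hcont : ContinuousOn f (Icc a b) := by
    intro t ht
    have he := hchart (c t)
    have hx := hmem (c t)
    have hsrc : ∀ᶠ s in 𝓝[Icc a b] t, c s ∈ (chart (c t)).source :=
      (hcC.continuousOn t ht).preimage_mem_nhdsWithin ((chart (c t)).open_source.mem_nhds hx)
    refine ContinuousWithinAt.congr_of_eventuallyEq (f := F (chart (c t))) ?_ ?_ (hfF he ht hx)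
    · have hcomp (p) := hu.continuousWithinAt_comp hcC.continuousOn ht he hx p
      refine tendsto_finsetSum _ fun i _ => tendsto_finsetSum _ fun j _ =>
        (Tendsto.mul ?_ (hcomp i.succ)).mul (hcomp j.succ)
      exact (L.contDiffAt_mass he ((chart (c t)).map_source hx) i j).continuousAt.tendsto.comp
        (((chart (c t)).continuousAt hx).tendsto.comp (hcC.continuousOn t ht))
    · filter_upwards [hsrc, self_mem_nhdsWithin] with s hs hsS using hfF he hsS hs
  have hzero {s : ℝ} (h : u s = 0) : f s = 0 := by
    simp [f, F, h, TimeMechanics.comp_fun_zero, TimeMechanics.QuadraticLagrangian.massForm]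
  have hle := TimeMechanics.nonpos_of_second_deriv_nonneg hcont (hzero hua) (hzero hub)
    (fun t ht => by
      have hS : Icc a b ∈ 𝓝 t := Icc_mem_nhds ht.1 ht.2
      obtain ⟨g, r, hg, hr, h0⟩ := hu.exists_second_deriv_massForm hcC hR hsub (hchart (c t)) ht
        (hmem (c t)) hvert
      have hfe : f =ᶠ[𝓝 t] F (chart (c t)) := by
        filter_upwards [hS, TimeMechanics.QuadraticLagrangian.eventually_mem_source hcC hS
          (hmem (c t))] with s hs hxs using hfF (hchart (c t)) hs hxs
      refine ⟨g, r, ?_, hr, h0⟩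
      filter_upwards [hg, hfe.eventuallyEq_nhds] with s hs hfs
        using HasDerivAt.congr_of_eventuallyEq hs hfs) t₀ ht₀
  have hspace := L.eq_zero_of_massForm_nonpos (hchart (c t₀))
    ((chart (c t₀)).map_source (hmem (c t₀))) hle
  -- The spatial components vanish by positive definiteness, the temporal one by verticality.
  refine hne ((hchart (c t₀)).eq_zero_of_comp_eq_zero (hmem (c t₀)) (funext fun p => ?_))
  refine Fin.cases ?_ (fun i => congrFun hspace i) p
  exact ((hchart (c t₀)).comp_zero (hmem (c t₀)) _).trans (hvert t₀ ht₀)
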